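/- Let $G=(V,E)$ be a finite, undirected, connected graph without loops or multiple edges, with $n=|V|\ge 2$ vertices. Write $d_x$ for the degree of $x\in V$, $d_{\min}=\min_{x\in V} d_x$ for the minimum degree and $d_{\mathrm{avg}}=\frac1n\sum_{x\in V}d_x$ for the average degree. Lazy random walk on $G$ is the discrete-time Markov chain $(X_t)_{t\ge 0}$ on $V$ with transition matrix $P(x,x)=\frac12$, $P(x,y)=\frac1{2d_x}$ if $xy\in E$, and $P(x,y)=0$ otherwise. Let $\tau_x=\inf\{t\ge 0: X_t=x\}$ and let $t_{\mathrm{hit}}=\max_{y,x\in V}\mathbb{E}_y[\tau_x]$, where $\mathbb{E}_y$ is the expectation for the walk started from $X_0=y$. The eigenvalues of $P$, counted with multiplicity, are real, $1=\lambda_1>\lambda_2\ge\dots\ge\lambda_n$; let $t_{\mathrm{rel}}=(1-\lambda_2)^{-1}$ be the relaxation time. Then \[ t_{\mathrm{hit}}\;\le\;\frac{20\,d_{\mathrm{avg}}}{d_{\min}}\;n\,\sqrt{t_{\mathrm{rel}}+1}. \] -/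

import Mathlib

open MeasureTheory ProbabilityTheory
open scoped ENNReal

namespace LazyWalk

noncomputable section

variable {V : Type*} [Fintype V] [DecidableEq V] (G : SimpleGraph V) [DecidableRel G.Adj]

/-- The transition matrix of lazy random walk on `G`. -/
def transition : Matrix V V ℝ := fun x y =>
  if y = x then 1 / 2 else if G.Adj x y then 1 / (2 * (G.degree x : ℝ)) else 0

/-- The average degree of `G`. -/
def avgDegree : ℝ := (∑ x, (G.degree x : ℝ)) / (Fintype.card V : ℝ)

/-- The second largest eigenvalue of the transition matrix: the real roots of the characteristic
polynomial are listed with multiplicity in decreasing order `λ₁ ≥ λ₂ ≥ ⋯`, and the entry `λ₂`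
(position `1`, counting from `0`) is taken. The default value is never used for a connected graph
with at least two vertices, as all `|V|` eigenvalues are then real. -/
def secondEigenvalue : ℝ :=
  ((transition G).charpoly.roots.sort (fun a b : ℝ => a ≥ b)).getD 1 0

/-- The relaxation time `(1 - λ₂)⁻¹` of lazy random walk. -/
def relaxationTime : ℝ := (1 - secondEigenvalue G)⁻¹

theorem transition_nonneg (x y : V) : 0 ≤ transition G x y := by
  unfold transition
  split_ifs <;> positivity

variable {G}

theorem sum_transition [Nontrivial V] (hG : G.Connected) (x : V) :
    ∑ y, transition G x y = 1 := by
  have hd : (0 : ℝ) < G.degree x := by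
    exact_mod_cast hG.preconnected.degree_pos_of_nontrivial x
  have h : ∀ y, transition G x y =
      (if y = x then (1 / 2 : ℝ) else 0) +
        (if G.Adj x y then 1 / (2 * (G.degree x : ℝ)) else 0) := by
    intro y
    unfold transition
    by_cases hy : y = x
    · subst hy
      simp
    · simp [hy]
  have hc : ((Finset.univ.filter fun y => G.Adj x y).card : ℝ) = G.degree x := by
    rw [← SimpleGraph.card_neighborFinset_eq_degree, SimpleGraph.neighborFinset_eq_filter]
  simp_rw [h]
  rw [Finset.sum_add_distrib, Finset.sum_ite_eq', ← Finset.sum_filter, Finset.sum_const,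
    nsmul_eq_mul, hc]
  simp only [Finset.mem_univ, if_true]
  field_simp
  norm_num

/-- The law of one step of lazy random walk from `x`: the row `P(x, ·)`. -/
def stepPMF [Nontrivial V] (hG : G.Connected) (x : V) : PMF V :=
  PMF.ofFintype (fun y => ENNReal.ofReal (transition G x y)) (by
    rw [← ENNReal.ofReal_sum_of_nonneg (fun y _ => transition_nonneg G x y),
      sum_transition hG x, ENNReal.ofReal_one])

variable [MeasurableSpace V] [DiscreteMeasurableSpace V]

/-- The Markov kernel on `V` of lazy random walk. -/
def stepKernel [Nontrivial V] (hG : G.Connected) : Kernel V V :=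
  Kernel.ofFunOfCountable fun x => (stepPMF hG x).toMeasure

instance stepKernel_isMarkovKernel [Nontrivial V] (hG : G.Connected) : IsMarkovKernel (stepKernel hG) :=
  ⟨fun x => inferInstanceAs (IsProbabilityMeasure (stepPMF hG x).toMeasure)⟩

/-- The law on the trajectory space `ℕ → V` of lazy random walk started from `y`: `X₀ = y`, and
given `X₀, …, Xₙ` the next position `Xₙ₊₁` has law `P(Xₙ, ·)`. The walk itself is the coordinate
process. -/
def walkMeasure [Nontrivial V] (hG : G.Connected) (y : V) : Measure (ℕ → V) :=
  Kernel.trajMeasure (X := fun _ => V) (Measure.dirac y) fun n =>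
    (stepKernel hG).comap (fun h : (Finset.Iic n → V) => h ⟨n, Finset.mem_Iic.2 le_rfl⟩)
      (measurable_pi_apply _)

/-- The hitting time `inf {t ≥ 0 : X_t = x}` of `x` along a trajectory (`∞` if never hit). -/
def hittingTime {V : Type*} (x : V) (ω : ℕ → V) : ℕ∞ :=
  hittingAfter (fun (t : ℕ) (ω : ℕ → V) => ω t) {x} 0 ω

/-- The expected hitting time of `x` from `y`, as an extended nonnegative real. -/
def expectedHittingTime [Nontrivial V] (hG : G.Connected) (y x : V) : ℝ≥0∞ :=
  ∫⁻ ω, (hittingTime x ω : ℝ≥0∞) ∂(walkMeasure hG y)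

/-- The maximum expected hitting time (a supremum over finitely many pairs). -/
def maxHittingTime [Nontrivial V] (hG : G.Connected) : ℝ≥0∞ :=
  ⨆ (y : V) (x : V), expectedHittingTime hG y x

end

end LazyWalk

/-!
Write `δ`, `E` and `λ₂` for the minimum degree, the Dirichlet energy and the second eigenvalue. If
`g ≤ s` outside a vertex set `A ≠ V` containing `x`, then `δ (g x - s) ^ 2 ≤ 4 |A| E(g)`: when `x`
has a neighbour outside `A`, the edges from `x` leaving `A` carry enough energy; otherwise take a
geodesic from `x` to the nearest vertex outside `A`, which has length `O(|A| / δ)` because the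
neighbourhoods of every third vertex on it are disjoint and contained in `A`. Applied to two
superlevel sets of `f⁺` and of `f⁻`, this gives `δ (f x - f y) ^ 4 ≤ 200 E(f) ∑ f ^ 2` whenever
`f y ≤ 0 ≤ f x`. With the Poincaré inequality `2 (1 - λ₂) ∑ deg f ^ 2 ≤ E(f)` for `f` of
degree-weighted mean zero, it follows that `δ (f x - f y) ^ 2 ≤ 10 √t_rel E(f)` for every `f`.

Fix `x` and let `H` solve `H x = 0` and `L H = 2 deg` off `x`, where `L` is the graph Laplacian.
Then `H = 1 + P H` off `x`, so `H` dominates the expected hitting times of `x`, and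
`E(H) = 2 ∑ deg H` is at most `2 n d_avg max H`. The last inequality at the maximum of `H` thus
bounds `max H`.
-/

namespace LazyWalk

open Finset Matrix

theorem add_sq_le_add_mul_add_of_sq_le_mul {R : Type*} [CommSemiring R] [LinearOrder R]
    [IsStrictOrderedRing R] [ExistsAddOfLE R] {p q a b c d : R} (ha : 0 ≤ a) (hb : 0 ≤ b)
    (hc : 0 ≤ c) (hd : 0 ≤ d) (hp : p ^ 2 ≤ a * c) (hq : q ^ 2 ≤ b * d) :
    (p + q) ^ 2 ≤ (a + b) * (c + d) := by
  simpa using sum_sq_le_sum_mul_sum_of_sq_le_mul univ (r := ![p, q]) (f := ![a, b]) (g := ![c, d])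
    (by simp [Fin.forall_fin_two, ha, hb]) (by simp [Fin.forall_fin_two, hc, hd])
    (by simp [Fin.forall_fin_two, hp, hq])

section Energy

variable {V : Type*}

/-- The squared increment of `g` along an edge, as a function of the unordered edge. -/
def sqIncrement (g : V → ℝ) : Sym2 V → ℝ :=
  Sym2.lift ⟨fun u v => (g u - g v) ^ 2, fun _ _ => sub_sq_comm _ _⟩

theorem sqIncrement_mk (g : V → ℝ) (u v : V) : sqIncrement g s(u, v) = (g u - g v) ^ 2 := rfl

theorem sqIncrement_nonneg (g : V → ℝ) (e : Sym2 V) : 0 ≤ sqIncrement g e :=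
  e.ind fun _ _ => sq_nonneg _

theorem sqIncrement_posPart_add_negPart_le (f : V → ℝ) (e : Sym2 V) :
    sqIncrement f⁺ e + sqIncrement f⁻ e ≤ sqIncrement f e := by
  induction e with | _ u v
  simp only [sqIncrement_mk, Pi.posPart_apply, Pi.negPart_apply]
  rcases le_total 0 (f u) with hu | hu <;> rcases le_total 0 (f v) with hv | hv <;>
    simp only [posPart_of_nonneg, posPart_of_nonpos, negPart_of_nonneg, negPart_of_nonpos, hu,
      hv] <;>
    nlinarith

theorem sub_sq_le_length_mul_sum_sqIncrement {G : SimpleGraph V} (g : V → ℝ) {x w : V}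
    (p : G.Walk x w) :
    (g x - g w) ^ 2 ≤ p.length * (p.edges.map (sqIncrement g)).sum := by
  induction p with
  | nil => simp
  | @cons x v w _ p ih =>
    have hsum : 0 ≤ (p.edges.map (sqIncrement g)).sum :=
      List.sum_nonneg fun r hr => by
        obtain ⟨e, -, rfl⟩ := List.mem_map.1 hr
        exact sqIncrement_nonneg g e
    have h := add_sq_le_add_mul_add_of_sq_le_mul (p := g x - g v) zero_le_one
      p.length.cast_nonneg (sqIncrement_nonneg g s(x, v)) hsum (one_mul _).ge ih
    simpa [add_comm] using h

variable [Fintype V] (G : SimpleGraph V) [DecidableRel G.Adj]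

/-- The Dirichlet energy of `g`: the sum over the edges of the squared increments of `g`. -/
noncomputable def energy (g : V → ℝ) : ℝ :=
  ∑ e ∈ G.edgeFinset, sqIncrement g e

theorem energy_nonneg (g : V → ℝ) : 0 ≤ energy G g :=
  sum_nonneg fun e _ => sqIncrement_nonneg g e

theorem energy_sub_const (g : V → ℝ) (c : ℝ) : energy G (fun v => g v - c) = energy G g :=
  sum_congr rfl fun e _ => e.ind fun u v => by simp only [sqIncrement_mk, sub_sub_sub_cancel_right]

theorem energy_posPart_add_negPart_le (f : V → ℝ) :
    energy G f⁺ + energy G f⁻ ≤ energy G f := by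
  rw [energy, energy, ← sum_add_distrib]
  exact sum_le_sum fun e _ => sqIncrement_posPart_add_negPart_le f e

theorem sum_neighborFinset_sub_sq_le_energy (g : V → ℝ) (x : V) :
    ∑ v ∈ G.neighborFinset x, (g x - g v) ^ 2 ≤ energy G g := by
  classical
  calc ∑ v ∈ G.neighborFinset x, (g x - g v) ^ 2
      = ∑ e ∈ (G.neighborFinset x).image (s(x, ·)), sqIncrement g e :=
        (sum_image (f := sqIncrement g) fun _ _ _ _ h => Sym2.congr_right.1 h).symm
    _ ≤ energy G g := by
        refine sum_le_sum_of_subset_of_nonneg (image_subset_iff.2 fun v hv => ?_)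
          fun e _ _ => sqIncrement_nonneg g e
        simpa using hv

variable {G}

theorem sub_sq_le_dist_mul_energy (g : V → ℝ) {x w : V} (h : G.Reachable x w) :
    (g x - g w) ^ 2 ≤ G.dist x w * energy G g := by
  classical
  obtain ⟨p, hp, hlen⟩ := h.exists_path_of_dist
  calc (g x - g w) ^ 2 ≤ p.length * (p.edges.map (sqIncrement g)).sum :=
        sub_sq_le_length_mul_sum_sqIncrement g p
    _ = G.dist x w * ∑ e ∈ p.edges.toFinset, sqIncrement g e := by
        rw [hlen, List.sum_toFinset _ hp.isTrail.edges_nodup]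
    _ ≤ G.dist x w * energy G g := by
        refine mul_le_mul_of_nonneg_left ?_ (Nat.cast_nonneg _)
        refine sum_le_sum_of_subset_of_nonneg (fun e he => ?_) fun e _ _ => sqIncrement_nonneg g e
        exact SimpleGraph.mem_edgeFinset.2 (p.edges_subset_edgeSet (List.mem_toFinset.1 he))

theorem sum_sum_ite_adj_eq_two_mul_sum_edgeFinset {R : Type*} [NonAssocSemiring R]
    (F : Sym2 V → R) :
    ∑ u, ∑ v, (if G.Adj u v then F s(u, v) else 0) = 2 * ∑ e ∈ G.edgeFinset, F e := by
  classical
  have hmaps : ∀ d ∈ (univ : Finset G.Dart), d.edge ∈ G.edgeFinset := fun d _ =>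
    SimpleGraph.mem_edgeFinset.2 d.edge_mem
  calc ∑ u, ∑ v, (if G.Adj u v then F s(u, v) else 0) = ∑ d : G.Dart, F d.edge := by
        rw [← Fintype.sum_prod_type', ← sum_filter]
        exact (sum_bij' (fun d _ => d.toProd) (fun p hp => ⟨p, (mem_filter.1 hp).2⟩)
          (by simp) (by simp) (by simp) (by simp) fun _ _ => rfl).symm
    _ = ∑ e ∈ G.edgeFinset, ∑ d : G.Dart with d.edge = e, F e :=
        (sum_fiberwise_of_maps_to' hmaps F).symm
    _ = 2 * ∑ e ∈ G.edgeFinset, F e := by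
        rw [mul_sum]
        refine sum_congr rfl fun e he => ?_
        rw [sum_const, G.dart_edge_fiber_card e (SimpleGraph.mem_edgeFinset.1 he), nsmul_eq_mul,
          Nat.cast_ofNat]

theorem energy_eq_dotProduct_lapMatrix [DecidableEq V] (f : V → ℝ) :
    energy G f = f ⬝ᵥ (G.lapMatrix ℝ *ᵥ f) := by
  have h := sum_sum_ite_adj_eq_two_mul_sum_edgeFinset (G := G) (sqIncrement f)
  simp only [sqIncrement_mk] at h
  rw [← Matrix.toLinearMap₂'_apply', SimpleGraph.lapMatrix_toLinearMap₂', h,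
    mul_div_cancel_left₀ _ two_ne_zero, energy]

theorem eq_of_energy_eq_zero (hG : G.Connected) {f : V → ℝ} (hf : energy G f = 0) (u v : V) :
    f u = f v := by
  classical
  rw [energy_eq_dotProduct_lapMatrix, ← Matrix.toLinearMap₂'_apply',
    G.lapMatrix_toLinearMap₂'_apply'_eq_zero_iff_forall_reachable] at hf
  exact hf u v (hG u v)

end Energy

section Isoperimetry

variable {V : Type*} {G : SimpleGraph V}

theorem exists_dist_eq_of_le_dist {x w : V} {k : ℕ} (h : G.Reachable x w) (hk : k ≤ G.dist x w) :
    ∃ v, G.dist x v = k := by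
  obtain ⟨p, hp⟩ := h.exists_walk_length_eq_dist
  refine ⟨p.getVert k, ?_⟩
  rw [← SimpleGraph.length_eq_dist_of_subwalk hp (p.isSubwalk_take k), SimpleGraph.Walk.take_length,
    min_eq_left (hp ▸ hk)]

variable [Fintype V] [DecidableRel G.Adj]

theorem div_three_mul_succ_minDegree_le_card_dist_lt {x w : V} (h : G.Reachable x w) :
    (G.dist x w + 1) / 3 * (G.minDegree + 1) ≤ #{v | G.dist x v < G.dist x w} := by
  classical
  have : Nonempty V := ⟨x⟩
  choose! c hc using fun k (hk : k ≤ G.dist x w) => exists_dist_eq_of_le_dist h hk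
  let B : ℕ → Finset V := fun j => insert (c (3 * j)) (G.neighborFinset (c (3 * j)))
  have hB : ∀ j < (G.dist x w + 1) / 3, ∀ v ∈ B j,
      G.dist x v ≤ 3 * j + 1 ∧ 3 * j ≤ G.dist x v + 1 := by
    intro j hj v hv
    have hcj := hc (3 * j) (by lia)
    rcases mem_insert.1 hv with rfl | hv
    · lia
    · have := ((G.mem_neighborFinset _ _).1 hv).diff_dist_adj (u := x)
      lia
  have hdisj : (range ((G.dist x w + 1) / 3) : Set ℕ).PairwiseDisjoint B := fun i hi j hj hij => by
    rw [Function.onFun, Finset.disjoint_left]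
    intro v hvi hvj
    have := hB i (mem_range.1 hi) v hvi
    have := hB j (mem_range.1 hj) v hvj
    lia
  calc (G.dist x w + 1) / 3 * (G.minDegree + 1)
      = ∑ _j ∈ range ((G.dist x w + 1) / 3), (G.minDegree + 1) := by simp
    _ ≤ ∑ j ∈ range ((G.dist x w + 1) / 3), #(B j) := sum_le_sum fun j _ => by
        rw [card_insert_of_notMem (by simp), SimpleGraph.card_neighborFinset_eq_degree]
        exact Nat.succ_le_succ (G.minDegree_le_degree _)
    _ = #((range ((G.dist x w + 1) / 3)).biUnion B) := (card_biUnion hdisj).symm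
    _ ≤ #{v | G.dist x v < G.dist x w} := card_le_card fun v hv => by
        obtain ⟨j, hj, hvj⟩ := mem_biUnion.1 hv
        have hj := mem_range.1 hj
        have := hB j hj v hvj
        exact mem_filter.2 ⟨mem_univ v, by lia⟩

theorem degree_le_card_mul_card_neighborFinset_sdiff [DecidableEq V] {A : Finset V} {x z : V}
    (hx : x ∈ A) (hxz : G.Adj x z) (hz : z ∉ A) :
    G.degree x ≤ #A * #(G.neighborFinset x \ A) := by
  have hA : 0 < #A := card_pos.2 ⟨x, hx⟩
  have hK : 0 < #(G.neighborFinset x \ A) := card_pos.2 ⟨z, by simp [hxz, hz]⟩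
  have hcover : G.degree x + 1 ≤ #A + #(G.neighborFinset x \ A) := by
    rw [← SimpleGraph.card_neighborFinset_eq_degree,
      ← card_insert_of_notMem (G.notMem_neighborFinset_self x)]
    refine (card_le_card fun v hv => ?_).trans (card_union_le _ _)
    by_cases hvA : v ∈ A
    · exact mem_union_left _ hvA
    · have hvx : v ≠ x := fun h => hvA (h ▸ hx)
      exact mem_union_right _ (mem_sdiff.2 ⟨mem_of_mem_insert_of_ne hv hvx, hvA⟩)
  nlinarith

theorem minDegree_mul_sub_sq_le_of_adj_notMem {A : Finset V} {g : V → ℝ} {s : ℝ} {x z : V}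
    (hx : x ∈ A) (hsx : s ≤ g x) (hs : ∀ v ∉ A, g v ≤ s) (hxz : G.Adj x z) (hz : z ∉ A) :
    G.minDegree * (g x - s) ^ 2 ≤ #A * energy G g := by
  classical
  have hdeg : (G.minDegree : ℝ) ≤ #A * #(G.neighborFinset x \ A) := by
    exact_mod_cast (G.minDegree_le_degree x).trans
      (degree_le_card_mul_card_neighborFinset_sdiff hx hxz hz)
  have hstar : #(G.neighborFinset x \ A) * (g x - s) ^ 2 ≤ energy G g :=
    calc #(G.neighborFinset x \ A) * (g x - s) ^ 2
        ≤ ∑ v ∈ G.neighborFinset x \ A, (g x - g v) ^ 2 := by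
          rw [← nsmul_eq_mul]
          refine card_nsmul_le_sum _ _ _ fun v hv => ?_
          have := hs v (mem_sdiff.1 hv).2
          gcongr
      _ ≤ ∑ v ∈ G.neighborFinset x, (g x - g v) ^ 2 :=
          sum_le_sum_of_subset_of_nonneg sdiff_subset fun _ _ _ => sq_nonneg _
      _ ≤ energy G g := sum_neighborFinset_sub_sq_le_energy G g x
  calc G.minDegree * (g x - s) ^ 2
      ≤ #A * #(G.neighborFinset x \ A) * (g x - s) ^ 2 := by gcongr
    _ = #A * (#(G.neighborFinset x \ A) * (g x - s) ^ 2) := mul_assoc _ _ _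
    _ ≤ #A * energy G g := by gcongr

theorem minDegree_mul_sub_sq_le_of_forall_adj_mem (hG : G.Connected) {A : Finset V} {g : V → ℝ}
    {s : ℝ} {x z : V} (hx : x ∈ A) (hsx : s ≤ g x) (hs : ∀ v ∉ A, g v ≤ s)
    (hadj : ∀ v, G.Adj x v → v ∈ A) (hz : z ∉ A) :
    G.minDegree * (g x - s) ^ 2 ≤ 4 * #A * energy G g := by
  classical
  obtain ⟨w, hw, hmin⟩ := exists_min_image Aᶜ (G.dist x) ⟨z, mem_compl.2 hz⟩
  have hwA : w ∉ A := mem_compl.1 hw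
  have hdist : 2 ≤ G.dist x w :=
    hG.one_lt_dist_of_ne_of_not_adj (fun h => hwA (h ▸ hx)) fun h => hwA (hadj w h)
  have hball : (G.dist x w + 1) / 3 * (G.minDegree + 1) ≤ #A :=
    (div_three_mul_succ_minDegree_le_card_dist_lt (hG x w)).trans <| card_le_card fun v hv =>
      not_not.1 fun hvA => (hmin v (mem_compl.2 hvA)).not_gt (mem_filter.1 hv).2
  have hcard : G.minDegree * G.dist x w ≤ 4 * #A := by
    have hround : G.dist x w ≤ 4 * ((G.dist x w + 1) / 3) := by lia
    nlinarith
  have hcard' : (G.minDegree * G.dist x w : ℝ) ≤ 4 * #A := by exact_mod_cast hcard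
  have hsw := hs w hwA
  calc G.minDegree * (g x - s) ^ 2 ≤ G.minDegree * (g x - g w) ^ 2 := by gcongr
    _ ≤ G.minDegree * (G.dist x w * energy G g) := by
        gcongr
        exact sub_sq_le_dist_mul_energy g (hG x w)
    _ = G.minDegree * G.dist x w * energy G g := (mul_assoc _ _ _).symm
    _ ≤ 4 * #A * energy G g := mul_le_mul_of_nonneg_right hcard' (energy_nonneg G g)

theorem minDegree_mul_sub_sq_le_card_mul_energy (hG : G.Connected) {A : Finset V} {g : V → ℝ}
    {s : ℝ} {x z : V} (hx : x ∈ A) (hsx : s ≤ g x) (hs : ∀ v ∉ A, g v ≤ s) (hz : z ∉ A) :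
    G.minDegree * (g x - s) ^ 2 ≤ 4 * #A * energy G g := by
  by_cases! hexit : ∃ v, G.Adj x v ∧ v ∉ A
  · obtain ⟨v, hxv, hv⟩ := hexit
    have hone := minDegree_mul_sub_sq_le_of_adj_notMem hx hsx hs hxv hv
    have : 0 ≤ #A * energy G g := mul_nonneg (Nat.cast_nonneg _) (energy_nonneg G g)
    linarith
  · exact minDegree_mul_sub_sq_le_of_forall_adj_mem hG hx hsx hs hexit hz

end Isoperimetry

section Nash

theorem sq_mul_card_add_sq_sub_sq_mul_card_le_sum_sq {ι : Type*} [Fintype ι] {g : ι → ℝ} {s t : ℝ}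
    (hs : 0 ≤ s) (hst : s ≤ t) :
    s ^ 2 * #{i | s < g i} + (t ^ 2 - s ^ 2) * #{i | t < g i} ≤ ∑ i, g i ^ 2 := by
  rw [← sum_boole, ← sum_boole, mul_sum, mul_sum, ← sum_add_distrib]
  refine sum_le_sum fun i _ => ?_
  split_ifs <;> nlinarith

variable {V : Type*} [Fintype V] {G : SimpleGraph V} [DecidableRel G.Adj]

theorem minDegree_mul_pow_four_le_energy_mul_sum_sq (hG : G.Connected) {g : V → ℝ} {x z : V}
    (hx : 0 ≤ g x) (hz : g z ≤ 0) :
    G.minDegree * g x ^ 4 ≤ 50 * energy G g * ∑ v, g v ^ 2 := by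
  have hE := energy_nonneg G g
  have hS : 0 ≤ energy G g * ∑ v, g v ^ 2 := mul_nonneg hE (sum_nonneg fun v _ => sq_nonneg (g v))
  rcases hx.eq_or_lt with h0 | h0
  · rw [← h0]
    linarith
  have hiso (s : ℝ) (hs : 0 ≤ s) (hsx : s < g x) :
      G.minDegree * (g x - s) ^ 2 ≤ 4 * #{v | s < g v} * energy G g :=
    minDegree_mul_sub_sq_le_card_mul_energy hG (x := x) (z := z) (by simpa using hsx) hsx.le
      (by simp) (by simpa using hz.trans hs)
  have hlow := hiso (1 / 3 * g x) (by linarith) (by linarith)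
  have hhigh := hiso (2 / 3 * g x) (by linarith) (by linarith)
  have hlayer := sq_mul_card_add_sq_sub_sq_mul_card_le_sum_sq (g := g) (s := 1 / 3 * g x)
    (t := 2 / 3 * g x) (by linarith) (by linarith)
  set M : ℝ := ((#{v | 1 / 3 * g x < g v} : ℕ) : ℝ)
  set N : ℝ := ((#{v | 2 / 3 * g x < g v} : ℕ) : ℝ)
  have hsum : 7 / 81 * (G.minDegree * g x ^ 4) ≤ 4 * (energy G g * ∑ v, g v ^ 2) :=
    calc 7 / 81 * (G.minDegree * g x ^ 4)
        = (1 / 3 * g x) ^ 2 * (G.minDegree * (g x - 1 / 3 * g x) ^ 2) +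
            ((2 / 3 * g x) ^ 2 - (1 / 3 * g x) ^ 2) *
              (G.minDegree * (g x - 2 / 3 * g x) ^ 2) := by ring
      _ ≤ (1 / 3 * g x) ^ 2 * (4 * M * energy G g) +
            ((2 / 3 * g x) ^ 2 - (1 / 3 * g x) ^ 2) * (4 * N * energy G g) := by
          gcongr
          linarith [sq_nonneg (g x)]
      _ = 4 * energy G g *
            ((1 / 3 * g x) ^ 2 * M + ((2 / 3 * g x) ^ 2 - (1 / 3 * g x) ^ 2) * N) := by ring
      _ ≤ 4 * energy G g * ∑ v, g v ^ 2 := by gcongr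
      _ = 4 * (energy G g * ∑ v, g v ^ 2) := mul_assoc _ _ _
  linarith

theorem sum_posPart_sq_add_sum_negPart_sq {ι : Type*} [Fintype ι] (f : ι → ℝ) :
    ∑ i, f⁺ i ^ 2 + ∑ i, f⁻ i ^ 2 = ∑ i, f i ^ 2 := by
  rw [← sum_add_distrib]
  refine sum_congr rfl fun i _ => ?_
  rcases le_total 0 (f i) with h | h <;>
    simp [posPart_of_nonneg, posPart_of_nonpos, negPart_of_nonneg, negPart_of_nonpos, h]

theorem minDegree_mul_sub_pow_four_le (hG : G.Connected) {f : V → ℝ} {x y : V} (hx : 0 ≤ f x)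
    (hy : f y ≤ 0) :
    G.minDegree * (f x - f y) ^ 4 ≤ 200 * energy G f * ∑ v, f v ^ 2 := by
  have hpos := minDegree_mul_pow_four_le_energy_mul_sum_sq hG (g := f⁺) (x := x) (z := y)
    (posPart_nonneg _) (posPart_of_nonpos hy).le
  have hneg := minDegree_mul_pow_four_le_energy_mul_sum_sq hG (g := f⁻) (x := y) (z := x)
    (negPart_nonneg _) (negPart_of_nonneg hx).le
  rw [Pi.posPart_apply, posPart_of_nonneg hx] at hpos
  rw [Pi.negPart_apply, negPart_of_nonpos hy] at hneg
  have hδ : √(G.minDegree : ℝ) ^ 2 = G.minDegree := Real.sq_sqrt (Nat.cast_nonneg _)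
  have hsplit : (√(G.minDegree : ℝ) * f x ^ 2 + √(G.minDegree : ℝ) * (-f y) ^ 2) ^ 2 ≤
      (50 * energy G f⁺ + 50 * energy G f⁻) * (∑ v, f⁺ v ^ 2 + ∑ v, f⁻ v ^ 2) :=
    add_sq_le_add_mul_add_of_sq_le_mul (mul_nonneg (by norm_num) (energy_nonneg G _))
      (mul_nonneg (by norm_num) (energy_nonneg G _)) (sum_nonneg fun v _ => sq_nonneg _)
      (sum_nonneg fun v _ => sq_nonneg _) (by rw [mul_pow, hδ, ← pow_mul]; exact hpos)
      (by rw [mul_pow, hδ, ← pow_mul]; exact hneg)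
  have hsq : (f x - f y) ^ 2 ≤ 2 * (f x ^ 2 + (-f y) ^ 2) := by
    simpa only [sub_eq_add_neg] using add_sq_le (a := f x) (b := -f y)
  calc G.minDegree * (f x - f y) ^ 4
      = G.minDegree * ((f x - f y) ^ 2) ^ 2 := by rw [← pow_mul]
    _ ≤ G.minDegree * (2 * (f x ^ 2 + (-f y) ^ 2)) ^ 2 := by gcongr
    _ = 4 * (√(G.minDegree : ℝ) * f x ^ 2 + √(G.minDegree : ℝ) * (-f y) ^ 2) ^ 2 := by
        rw [← mul_add, mul_pow, mul_pow, hδ]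
        ring
    _ ≤ 4 * ((50 * energy G f⁺ + 50 * energy G f⁻) * (∑ v, f⁺ v ^ 2 + ∑ v, f⁻ v ^ 2)) := by
        gcongr
    _ = 200 * (energy G f⁺ + energy G f⁻) * ∑ v, f v ^ 2 := by
        rw [sum_posPart_sq_add_sum_negPart_sq]
        ring
    _ ≤ 200 * energy G f * ∑ v, f v ^ 2 := by
        gcongr
        exact energy_posPart_add_negPart_le G f

end Nash

section SymmetricOperator

open Module RCLike
open scoped InnerProductSpace

variable {𝕜 E : Type*} [RCLike 𝕜] [NormedAddCommGroup E] [InnerProductSpace 𝕜 E]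
  [FiniteDimensional 𝕜 E] {T : E →ₗ[𝕜] E} {n : ℕ}

theorem re_inner_apply_self_eq_sum_eigenvalues (hT : T.IsSymmetric) (hn : finrank 𝕜 E = n) (x : E) :
    re ⟪x, T x⟫_𝕜 = ∑ i, hT.eigenvalues hn i * ‖⟪hT.eigenvectorBasis hn i, x⟫_𝕜‖ ^ 2 := by
  rw [← (hT.eigenvectorBasis hn).sum_inner_mul_inner x (T x), map_sum]
  refine sum_congr rfl fun i _ => ?_
  rw [← hT, hT.apply_eigenvectorBasis, inner_smul_left, conj_ofReal, mul_left_comm,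
    re_ofReal_mul, inner_mul_symm_re_eq_norm, norm_mul, norm_inner_symm, sq]

theorem inner_eigenvectorBasis_eq_zero_of_apply_eq_smul (hT : T.IsSymmetric)
    (hn : finrank 𝕜 E = n) {μ : ℝ} {φ : E} (hφ : T φ = (μ : 𝕜) • φ) {i : Fin n}
    (hi : hT.eigenvalues hn i ≠ μ) : ⟪hT.eigenvectorBasis hn i, φ⟫_𝕜 = 0 := by
  have h := hT (hT.eigenvectorBasis hn i) φ
  rw [hφ, hT.apply_eigenvectorBasis, inner_smul_left, inner_smul_right, conj_ofReal] at h
  exact (mul_eq_mul_right_iff.1 h).resolve_left fun h => hi (ofReal_injective h)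

theorem eigenvalues_one_lt_of_forall_mem_span (hT : T.IsSymmetric) (hn : finrank 𝕜 E = n)
    (h1 : 1 < n) {μ : ℝ} {φ : E} (hφ : ∀ v, μ * ‖v‖ ^ 2 ≤ re ⟪v, T v⟫_𝕜 → v ∈ 𝕜 ∙ φ) :
    hT.eigenvalues hn ⟨1, h1⟩ < μ := by
  by_contra! hμ
  set b := hT.eigenvectorBasis hn
  have hspan (i : Fin n) (hi : i ≤ ⟨1, h1⟩) : b i ∈ 𝕜 ∙ φ := by
    refine hφ _ ?_
    rw [hT.apply_eigenvectorBasis, inner_smul_right, inner_self_eq_norm_sq_to_K, b.norm_eq_one]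
    simpa using hμ.trans (hT.eigenvalues_antitone hn hi)
  obtain ⟨c, hc⟩ := Submodule.mem_span_singleton.1 (hspan ⟨0, by lia⟩ (by simp))
  obtain ⟨d, hd⟩ := Submodule.mem_span_singleton.1 (hspan ⟨1, h1⟩ le_rfl)
  have hne (i : Fin n) : b i ≠ 0 := b.orthonormal.ne_zero i
  have horth : ⟪b ⟨0, by lia⟩, b ⟨1, h1⟩⟫_𝕜 = 0 := b.orthonormal.2 (by simp)
  rw [← hc, ← hd, inner_smul_left, inner_smul_right, mul_eq_zero, mul_eq_zero, map_eq_zero,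
    inner_self_eq_zero] at horth
  rcases horth with rfl | rfl | rfl
  · exact hne _ (by rw [← hc, zero_smul])
  · exact hne _ (by rw [← hd, zero_smul])
  · exact hne _ (by rw [← hc, smul_zero])

theorem re_inner_apply_self_le_eigenvalues_one_mul (hT : T.IsSymmetric) (hn : finrank 𝕜 E = n)
    (h1 : 1 < n) {μ : ℝ} {φ x : E} (hφ0 : φ ≠ 0) (hφ : T φ = (μ : 𝕜) • φ)
    (hμ : hT.eigenvalues hn ⟨1, h1⟩ < μ) (hx : ⟪φ, x⟫_𝕜 = 0) :
    re ⟪x, T x⟫_𝕜 ≤ hT.eigenvalues hn ⟨1, h1⟩ * ‖x‖ ^ 2 := by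
  set b := hT.eigenvectorBasis hn with hb
  let i₀ : Fin n := ⟨0, by lia⟩
  have hle (i : Fin n) (hi : i ≠ i₀) : hT.eigenvalues hn i ≤ hT.eigenvalues hn ⟨1, h1⟩ :=
    hT.eigenvalues_antitone hn (Nat.one_le_iff_ne_zero.2 fun h => hi (Fin.ext h))
  have hφb : ⟪b i₀, φ⟫_𝕜 • b i₀ = φ := by
    rw [← Fintype.sum_eq_single (f := fun i => ⟪b i, φ⟫_𝕜 • b i) i₀, b.sum_repr']
    intro i hi
    rw [hb, inner_eigenvectorBasis_eq_zero_of_apply_eq_smul hT hn hφ ((hle i hi).trans_lt hμ).ne,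
      zero_smul]
  have hxb : ⟪b i₀, x⟫_𝕜 = 0 := by
    rw [← hφb, inner_smul_left, mul_eq_zero] at hx
    refine hx.resolve_left fun h => hφ0 ?_
    rw [← hφb, (map_eq_zero _).1 h, zero_smul]
  rw [re_inner_apply_self_eq_sum_eigenvalues hT hn, ← b.sum_sq_norm_inner_right x, mul_sum]
  refine sum_le_sum fun i _ => ?_
  rcases eq_or_ne i i₀ with rfl | hi
  · rw [hxb, norm_zero, zero_pow two_ne_zero, mul_zero, mul_zero]
  · exact mul_le_mul_of_nonneg_right (hle i hi) (sq_nonneg _)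

end SymmetricOperator

section Reversible

variable {V : Type*} {π : V → ℝ} {P : Matrix V V ℝ}

/-- Detailed balance of the matrix `P` with respect to the weights `π`. -/
def IsReversible (π : V → ℝ) (P : Matrix V V ℝ) : Prop :=
  ∀ x y, π x * P x y = π y * P y x

/-- The isomorphism `f ↦ √π * f` of the functions on `V` with Euclidean space, which turns the
weighted inner product `∑ x, π x * f x * g x` into the Euclidean one. -/
noncomputable def weightedEquiv (hπ : ∀ x, 0 < π x) : (V → ℝ) ≃ₗ[ℝ] EuclideanSpace ℝ V :=
  (LinearEquiv.piCongrRight fun x =>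
    LinearEquiv.smulOfNeZero ℝ ℝ √(π x) (Real.sqrt_pos.2 (hπ x)).ne') ≪≫ₗ
      (WithLp.linearEquiv 2 ℝ (V → ℝ)).symm

theorem weightedEquiv_apply (hπ : ∀ x, 0 < π x) (f : V → ℝ) (x : V) :
    weightedEquiv hπ f x = √(π x) * f x := rfl

variable [Fintype V]

theorem inner_weightedEquiv (hπ : ∀ x, 0 < π x) (f g : V → ℝ) :
    inner ℝ (weightedEquiv hπ f) (weightedEquiv hπ g) = ∑ x, π x * (f x * g x) := by
  rw [PiLp.inner_apply]
  refine sum_congr rfl fun x _ => ?_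
  rw [weightedEquiv_apply, weightedEquiv_apply, RCLike.inner_apply', conj_trivial]
  linear_combination (f x * g x) * Real.mul_self_sqrt (hπ x).le

theorem norm_weightedEquiv_sq (hπ : ∀ x, 0 < π x) (f : V → ℝ) :
    ‖weightedEquiv hπ f‖ ^ 2 = ∑ x, π x * f x ^ 2 := by
  rw [← real_inner_self_eq_norm_sq, inner_weightedEquiv]
  simp only [sq]

variable [DecidableEq V]

/-- The action of the matrix `P` transported by `weightedEquiv`; it is symmetric when `P` is
reversible with respect to `π`. -/
noncomputable def weightedConj (hπ : ∀ x, 0 < π x) (P : Matrix V V ℝ) :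
    EuclideanSpace ℝ V →ₗ[ℝ] EuclideanSpace ℝ V :=
  (weightedEquiv hπ).conj P.toLin'

theorem weightedConj_weightedEquiv (hπ : ∀ x, 0 < π x) (P : Matrix V V ℝ) (f : V → ℝ) :
    weightedConj hπ P (weightedEquiv hπ f) = weightedEquiv hπ (P *ᵥ f) := by
  simp [weightedConj, LinearEquiv.conj_apply]

theorem charpoly_weightedConj (hπ : ∀ x, 0 < π x) (P : Matrix V V ℝ) :
    (weightedConj hπ P).charpoly = P.charpoly := by
  rw [weightedConj, LinearEquiv.charpoly_conj, charpoly_toLin']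

theorem IsReversible.isSymmetric_weightedConj (hP : IsReversible π P) (hπ : ∀ x, 0 < π x) :
    (weightedConj hπ P).IsSymmetric := fun u v => by
  obtain ⟨f, rfl⟩ := (weightedEquiv hπ).surjective u
  obtain ⟨g, rfl⟩ := (weightedEquiv hπ).surjective v
  simp only [weightedConj_weightedEquiv, inner_weightedEquiv, mulVec, dotProduct, sum_mul, mul_sum]
  rw [sum_comm]
  refine sum_congr rfl fun x _ => sum_congr rfl fun y _ => ?_
  linear_combination (f x * g y) * hP y x

/-- The second entry in the decreasing list of the real roots of the characteristic polynomial,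
with the default value `0` when there are fewer than two. -/
noncomputable def secondRoot (P : Matrix V V ℝ) : ℝ :=
  (P.charpoly.roots.sort (· ≥ ·)).getD 1 0

variable [Nontrivial V]

theorem secondRoot_eq_eigenvalues (hπ : ∀ x, 0 < π x) (hT : (weightedConj hπ P).IsSymmetric) :
    secondRoot P = hT.eigenvalues finrank_euclideanSpace ⟨1, Fintype.one_lt_card⟩ := by
  have hroots := hT.sort_roots_charpoly_eq_eigenvalues (finrank_euclideanSpace (ι := V))
  simp only [charpoly_weightedConj, RCLike.re_to_real, Multiset.map_id'] at hroots
  rw [secondRoot, hroots, List.getD_eq_getElem _ _ (by simp [Fintype.one_lt_card]),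
    List.getElem_ofFn]

theorem IsReversible.secondRoot_lt_one (hP : IsReversible π P) (hπ : ∀ x, 0 < π x)
    (hconst : ∀ f : V → ℝ, ∑ x, π x * f x ^ 2 ≤ ∑ x, π x * (f x * (P *ᵥ f) x) →
      ∀ x y, f x = f y) : secondRoot P < 1 := by
  have hT := hP.isSymmetric_weightedConj hπ
  rw [secondRoot_eq_eigenvalues hπ hT]
  refine eigenvalues_one_lt_of_forall_mem_span hT _ _ (φ := weightedEquiv hπ 1) fun v hv => ?_
  obtain ⟨f, rfl⟩ := (weightedEquiv hπ).surjective v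
  rw [one_mul, norm_weightedEquiv_sq, weightedConj_weightedEquiv, RCLike.re_to_real,
    inner_weightedEquiv] at hv
  obtain ⟨x⟩ : Nonempty V := inferInstance
  refine Submodule.mem_span_singleton.2 ⟨f x, ?_⟩
  rw [← map_smul]
  congr 1
  ext y
  simp [hconst f hv x y]

theorem IsReversible.sum_mul_mulVec_le (hP : IsReversible π P) (hπ : ∀ x, 0 < π x)
    (hP1 : P *ᵥ 1 = 1) (hlt : secondRoot P < 1) {f : V → ℝ} (hf : ∑ x, π x * f x = 0) :
    ∑ x, π x * (f x * (P *ᵥ f) x) ≤ secondRoot P * ∑ x, π x * f x ^ 2 := by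
  have hT := hP.isSymmetric_weightedConj hπ
  rw [secondRoot_eq_eigenvalues hπ hT] at hlt ⊢
  have h := re_inner_apply_self_le_eigenvalues_one_mul hT finrank_euclideanSpace
    Fintype.one_lt_card (φ := weightedEquiv hπ 1) (x := weightedEquiv hπ f) (μ := 1)
    (by simp) (by simp [weightedConj_weightedEquiv, hP1]) hlt
    (by simpa [inner_weightedEquiv] using hf)
  rwa [weightedConj_weightedEquiv, RCLike.re_to_real, inner_weightedEquiv,
    norm_weightedEquiv_sq] at h

end Reversible

section Spectral

variable {V : Type*} [Fintype V] {G : SimpleGraph V} [DecidableRel G.Adj]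

variable (G) in
theorem avgDegree_nonneg : 0 ≤ avgDegree G :=
  div_nonneg (sum_nonneg fun _ _ => Nat.cast_nonneg _) (Nat.cast_nonneg _)

theorem sum_degree : ∑ x, (G.degree x : ℝ) = avgDegree G * Fintype.card V := by
  rcases isEmpty_or_nonempty V with _ | _
  · simp
  · rw [avgDegree, div_mul_cancel₀ _ (by exact_mod_cast Fintype.card_ne_zero)]

variable [DecidableEq V]

theorem degree_mul_transition (x y : V) :
    G.degree x * transition G x y =
      ((if y = x then (G.degree x : ℝ) else 0) + if G.Adj x y then 1 else 0) / 2 := by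
  by_cases hxy : G.Adj x y
  · have hd : (G.degree x : ℝ) ≠ 0 := by
      exact_mod_cast ((G.degree_pos_iff_exists_adj x).2 ⟨y, hxy⟩).ne'
    simp only [transition, hxy, hxy.ne', if_true, if_false]
    field_simp
    ring
  · simp only [transition, hxy, if_false]
    split_ifs <;> ring

theorem isReversible_transition : IsReversible (fun x => (G.degree x : ℝ)) (transition G) := by
  intro x y
  rw [degree_mul_transition, degree_mul_transition]
  rcases eq_or_ne y x with rfl | hyx
  · rfl
  · simp only [hyx, hyx.symm, G.adj_comm x y, if_false]

theorem degree_mul_sub_transition_mulVec (f : V → ℝ) (x : V) :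
    G.degree x * (f x - (transition G *ᵥ f) x) = (G.lapMatrix ℝ *ᵥ f) x / 2 := by
  rw [mul_sub, mulVec, dotProduct, mul_sum]
  simp only [← mul_assoc, degree_mul_transition, div_mul_eq_mul_div, add_mul, ite_mul, zero_mul,
    one_mul]
  rw [← sum_div, sum_add_distrib, Fintype.sum_ite_eq', ← sum_filter,
    ← SimpleGraph.neighborFinset_eq_filter, SimpleGraph.lapMatrix_mulVec_apply]
  ring

theorem sum_degree_mul_transition_mulVec (f : V → ℝ) :
    ∑ x, G.degree x * (f x * (transition G *ᵥ f) x) =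
      ∑ x, G.degree x * f x ^ 2 - energy G f / 2 := by
  rw [energy_eq_dotProduct_lapMatrix, dotProduct, sum_div, ← sum_sub_distrib]
  refine sum_congr rfl fun x _ => ?_
  linear_combination -f x * degree_mul_sub_transition_mulVec (G := G) f x

theorem secondEigenvalue_eq_secondRoot : secondEigenvalue G = secondRoot (transition G) := rfl

variable [Nontrivial V]

theorem secondEigenvalue_lt_one (hG : G.Connected) : secondEigenvalue G < 1 := by
  rw [secondEigenvalue_eq_secondRoot]
  refine isReversible_transition.secondRoot_lt_one
    (fun x => by exact_mod_cast hG.preconnected.degree_pos_of_nontrivial x) fun f hf => ?_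
  rw [sum_degree_mul_transition_mulVec] at hf
  exact eq_of_energy_eq_zero hG (by linarith [energy_nonneg G f])

theorem relaxationTime_nonneg (hG : G.Connected) : 0 ≤ relaxationTime G :=
  inv_nonneg.2 (sub_nonneg.2 (secondEigenvalue_lt_one hG).le)

theorem two_mul_sum_degree_mul_sq_le (hG : G.Connected) {f : V → ℝ}
    (hf : ∑ x, G.degree x * f x = 0) :
    2 * ∑ x, G.degree x * f x ^ 2 ≤ relaxationTime G * energy G f := by
  have hlt := secondEigenvalue_lt_one hG
  have hP1 : transition G *ᵥ 1 = 1 := by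
    ext x
    simpa [mulVec, dotProduct] using sum_transition hG x
  have h := isReversible_transition.sum_mul_mulVec_le
    (fun x => by exact_mod_cast hG.preconnected.degree_pos_of_nontrivial x) hP1 hlt hf
  rw [sum_degree_mul_transition_mulVec, ← secondEigenvalue_eq_secondRoot] at h
  rw [relaxationTime, ← div_eq_inv_mul, le_div_iff₀ (sub_pos.2 hlt)]
  linarith

theorem minDegree_mul_sub_sq_le_of_sum_degree_mul_eq_zero (hG : G.Connected) {f : V → ℝ} {x y : V}
    (hf : ∑ v, G.degree v * f v = 0) (hx : 0 ≤ f x) (hy : f y ≤ 0) :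
    G.minDegree * (f x - f y) ^ 2 ≤ 10 * √(relaxationTime G) * energy G f := by
  have hE := energy_nonneg G f
  have hvar : 2 * (G.minDegree * ∑ v, f v ^ 2) ≤ relaxationTime G * energy G f := by
    refine le_trans ?_ (two_mul_sum_degree_mul_sq_le hG hf)
    rw [mul_sum]
    gcongr
    exact G.minDegree_le_degree _
  refine abs_le_of_sq_le_sq' ?_ (by positivity) |>.2
  calc (G.minDegree * (f x - f y) ^ 2) ^ 2
      = G.minDegree * (G.minDegree * (f x - f y) ^ 4) := by ring
    _ ≤ G.minDegree * (200 * energy G f * ∑ v, f v ^ 2) := by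
        gcongr ?_ * ?_
        exact minDegree_mul_sub_pow_four_le hG hx hy
    _ = 100 * energy G f * (2 * (G.minDegree * ∑ v, f v ^ 2)) := by ring
    _ ≤ 100 * energy G f * (relaxationTime G * energy G f) := by gcongr
    _ = (10 * √(relaxationTime G) * energy G f) ^ 2 := by
        rw [mul_pow, mul_pow, Real.sq_sqrt (relaxationTime_nonneg hG)]
        ring

theorem minDegree_mul_sub_sq_le (hG : G.Connected) (f : V → ℝ) (x y : V) :
    G.minDegree * (f x - f y) ^ 2 ≤ 10 * √(relaxationTime G) * energy G f := by
  have hdeg (v : V) : (0 : ℝ) < G.degree v := by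
    exact_mod_cast hG.preconnected.degree_pos_of_nontrivial v
  let c := (∑ v, G.degree v * f v) / ∑ v, (G.degree v : ℝ)
  have hmean : ∑ v, G.degree v * (f v - c) = 0 := by
    simp only [mul_sub, sum_sub_distrib, ← sum_mul]
    rw [mul_div_cancel₀ _ (sum_pos (fun v _ => hdeg v) univ_nonempty).ne', sub_self]
  obtain ⟨M, hM⟩ := Finite.exists_max f
  obtain ⟨m, hm⟩ := Finite.exists_min f
  have hMc : 0 ≤ f M - c := by
    obtain ⟨v, -, hv⟩ := exists_le_of_sum_le univ_nonempty
      (show ∑ _v : V, (0 : ℝ) ≤ ∑ v, G.degree v * (f v - c) by rw [hmean, sum_const_zero])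
    linarith [nonneg_of_mul_nonneg_right hv (hdeg v), hM v]
  have hmc : f m - c ≤ 0 := by
    obtain ⟨v, -, hv⟩ := exists_le_of_sum_le univ_nonempty
      (show ∑ v, G.degree v * (f v - c) ≤ ∑ _v : V, (0 : ℝ) by rw [hmean, sum_const_zero])
    linarith [nonpos_of_mul_nonpos_right hv (hdeg v), hm v]
  have h := minDegree_mul_sub_sq_le_of_sum_degree_mul_eq_zero hG hmean hMc hmc
  rw [energy_sub_const, sub_sub_sub_cancel_right] at h
  refine le_trans (mul_le_mul_of_nonneg_left ?_ (Nat.cast_nonneg _)) h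
  exact sq_le_sq' (by linarith [hM y, hm x]) (by linarith [hM x, hm y])

end Spectral

section Poisson

variable {V : Type*} [Fintype V] [DecidableEq V] {G : SimpleGraph V} [DecidableRel G.Adj]

theorem sum_lapMatrix_mulVec (f : V → ℝ) : ∑ v, (G.lapMatrix ℝ *ᵥ f) v = 0 := by
  rw [← one_dotProduct, dotProduct_mulVec, ← mulVec_transpose, (G.isSymm_lapMatrix ℝ).eq]
  exact (congrArg (· ⬝ᵥ f) (G.lapMatrix_mulVec_const_eq_zero (R := ℝ))).trans (zero_dotProduct f)

theorem exists_lapMatrix_mulVec_eq (hG : G.Connected) {b : V → ℝ} (hb : ∑ v, b v = 0) (x : V) :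
    ∃ f : V → ℝ, f x = 0 ∧ G.lapMatrix ℝ *ᵥ f = b := by
  -- Grounding the Laplacian at `x` makes it invertible.
  let M := G.lapMatrix ℝ + diagonal (Pi.single x 1)
  have hM (f : V → ℝ) : M *ᵥ f = G.lapMatrix ℝ *ᵥ f + Pi.single x (f x) := by
    ext v
    rw [add_mulVec, Pi.add_apply, Pi.add_apply, mulVec_diagonal]
    rcases eq_or_ne v x with rfl | hv
    · simp
    · simp [hv]
  have hinj : Function.Injective M.mulVec := by
    rw [← coe_mulVecLin, injective_iff_map_eq_zero]
    intro f hf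
    have h : energy G f + f x * f x = 0 := by
      rw [energy_eq_dotProduct_lapMatrix, ← dotProduct_single, ← dotProduct_add, ← hM,
        ← mulVecLin_apply, hf, dotProduct_zero]
    obtain ⟨hE, hx⟩ := (add_eq_zero_iff_of_nonneg (energy_nonneg G f) (mul_self_nonneg _)).1 h
    ext v
    rw [eq_of_energy_eq_zero hG hE v x, mul_self_eq_zero.1 hx, Pi.zero_apply]
  obtain ⟨f, rfl⟩ := mulVec_surjective_iff_isUnit.2 (mulVec_injective_iff_isUnit.1 hinj) b
  have hx : f x = 0 := by
    simpa [hM, sum_add_distrib, sum_lapMatrix_mulVec] using hb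
  exact ⟨f, hx, by rw [hM, hx, Pi.single_zero, add_zero]⟩

theorem apply_le_of_lapMatrix_mulVec_pos {f : V → ℝ} {x : V}
    (hf : ∀ v ≠ x, 0 < (G.lapMatrix ℝ *ᵥ f) v) (v : V) : f x ≤ f v := by
  have : Nonempty V := ⟨x⟩
  obtain ⟨w, hw⟩ := Finite.exists_min f
  obtain rfl : w = x := by
    by_contra hwx
    have hle : G.degree w * f w ≤ ∑ u ∈ G.neighborFinset w, f u := by
      rw [← SimpleGraph.card_neighborFinset_eq_degree, ← nsmul_eq_mul]
      exact card_nsmul_le_sum _ _ _ fun u _ => hw u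
    have hpos := hf w hwx
    rw [SimpleGraph.lapMatrix_mulVec_apply] at hpos
    linarith
  exact hw v

variable [Nontrivial V]

theorem exists_transition_mulVec_add_one_eq (hG : G.Connected) (x : V) :
    ∃ f : V → ℝ, f x = 0 ∧ (∀ v, 0 ≤ f v) ∧ (∀ v ≠ x, (transition G *ᵥ f) v + 1 = f v) ∧
      energy G f = 2 * ∑ v, G.degree v * f v := by
  have hdeg (v : V) : (0 : ℝ) < G.degree v := by
    exact_mod_cast hG.preconnected.degree_pos_of_nontrivial v
  obtain ⟨f, hfx, hLf⟩ := exists_lapMatrix_mulVec_eq hG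
    (b := fun v => 2 * G.degree v - if v = x then 2 * ∑ u, (G.degree u : ℝ) else 0)
    (by rw [sum_sub_distrib, Fintype.sum_ite_eq', ← mul_sum, sub_self]) x
  have hoff (v : V) (hv : v ≠ x) : (G.lapMatrix ℝ *ᵥ f) v = 2 * G.degree v := by
    simp [hLf, hv]
  refine ⟨f, hfx, fun v => ?_, fun v hv => ?_, ?_⟩
  · rw [← hfx]
    refine apply_le_of_lapMatrix_mulVec_pos (G := G) (fun v hv => ?_) v
    rw [hoff v hv]
    exact mul_pos two_pos (hdeg v)
  · have h := degree_mul_sub_transition_mulVec (G := G) f v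
    rw [hoff v hv, mul_div_cancel_left₀ _ two_ne_zero, mul_eq_left₀ (hdeg v).ne'] at h
    linarith
  · rw [energy_eq_dotProduct_lapMatrix, dotProduct, mul_sum]
    refine sum_congr rfl fun v _ => ?_
    rcases eq_or_ne v x with rfl | hv
    · rw [hfx, zero_mul, mul_zero, mul_zero]
    · rw [hoff v hv]
      ring

theorem exists_transition_mulVec_add_one_eq_and_le (hG : G.Connected) (x : V) :
    ∃ f : V → ℝ, (∀ v, 0 ≤ f v) ∧ (∀ v ≠ x, (transition G *ᵥ f) v + 1 = f v) ∧
      ∀ v, f v ≤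
        20 * avgDegree G / G.minDegree * Fintype.card V * √(relaxationTime G) := by
  obtain ⟨f, hfx, hf0, hstep, henergy⟩ := exists_transition_mulVec_add_one_eq hG x
  refine ⟨f, hf0, hstep, fun v => ?_⟩
  have hδ : (0 : ℝ) < G.minDegree := by
    exact_mod_cast hG.preconnected.minDegree_pos_of_nontrivial
  obtain ⟨w, hw⟩ := Finite.exists_max f
  have hsum : ∑ u, G.degree u * f u ≤ avgDegree G * Fintype.card V * f w := by
    rw [← sum_degree, sum_mul]
    gcongr
    exact hw _
  have hmain : G.minDegree * f w * f w ≤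
      20 * (avgDegree G * Fintype.card V) * √(relaxationTime G) * f w :=
    calc G.minDegree * f w * f w = G.minDegree * (f w - f x) ^ 2 := by rw [hfx]; ring
      _ ≤ 10 * √(relaxationTime G) * (2 * ∑ u, G.degree u * f u) :=
          henergy ▸ minDegree_mul_sub_sq_le hG f w x
      _ ≤ 10 * √(relaxationTime G) * (2 * (avgDegree G * Fintype.card V * f w)) := by gcongr
      _ = 20 * (avgDegree G * Fintype.card V) * √(relaxationTime G) * f w := by ring
  have havg := avgDegree_nonneg G
  refine (hw v).trans ?_
  rcases (hf0 w).eq_or_lt with h0 | h0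
  · rw [← h0]
    positivity
  · calc f w ≤ 20 * (avgDegree G * Fintype.card V) * √(relaxationTime G) / G.minDegree := by
          rw [le_div_iff₀' hδ]
          exact le_of_mul_le_mul_right hmain h0
      _ = 20 * avgDegree G / G.minDegree * Fintype.card V * √(relaxationTime G) := by ring

end Poisson

section HittingTime

theorem toENNReal_eq_tsum_ite (n : ℕ∞) :
    (n : ℝ≥0∞) = ∑' t : ℕ, if (t : ℕ∞) < n then 1 else 0 := by
  induction n using ENat.recTopCoe with
  | top => simp
  | coe k =>
    rw [tsum_eq_sum (s := range k) (by simp)]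
    simp [filter_true_of_mem]

theorem lintegral_toENNReal_eq_tsum_measure_lt {Ω : Type*} [MeasurableSpace Ω] (μ : Measure Ω)
    {τ : Ω → ℕ∞} (hτ : ∀ t : ℕ, MeasurableSet {ω | t < τ ω}) :
    ∫⁻ ω, τ ω ∂μ = ∑' t : ℕ, μ {ω | t < τ ω} := by
  simp only [toENNReal_eq_tsum_ite (τ _)]
  rw [lintegral_tsum fun t =>
    (Measurable.ite (hτ t) measurable_const measurable_const).aemeasurable]
  refine tsum_congr fun t => ?_
  rw [← lintegral_indicator_one (hτ t)]
  simp only [Set.indicator_apply, Set.mem_ofPred_eq, Pi.one_apply]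

theorem tsum_le_of_add_succ_le {a b : ℕ → ℝ≥0∞} (h : ∀ t, a t + b (t + 1) ≤ b t) :
    ∑' t, a t ≤ b 0 := by
  have hsum (n : ℕ) : ∑ t ∈ range n, a t + b n ≤ b 0 := by
    induction n with
    | zero => simp
    | succ n ih =>
      rw [sum_range_succ, add_assoc]
      exact (add_le_add_right (h n) _).trans ih
  rw [ENNReal.tsum_eq_iSup_nat]
  exact iSup_le fun n => le_self_add.trans (hsum n)

variable {E : Type*}

/-- The hitting time `inf {t ≥ 0 : ω t ∈ S}` of the set `S` along a trajectory (`∞` if never hit);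
`hittingTime x` is the case `S = {x}`. -/
noncomputable def hittingTimeOfSet (S : Set E) (ω : ℕ → E) : ℕ∞ :=
  hittingAfter (fun (t : ℕ) (ω : ℕ → E) => ω t) S 0 ω

theorem setOf_lt_hittingTimeOfSet_eq_preimage (S : Set E) (t : ℕ) :
    {ω | t < hittingTimeOfSet S ω} =
      Preorder.frestrictLe (π := fun _ => E) t ⁻¹' Set.univ.pi fun _ => Sᶜ := by
  ext ω
  have h : hittingTimeOfSet S ω ≤ t ↔ ∃ i ∈ Set.Icc 0 t, ω i ∈ S := hittingAfter_le_iff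
  rw [Set.mem_ofPred_eq, ← not_le, h]
  simp [Set.mem_pi]

variable [MeasurableSpace E] {κ : Kernel E E} [IsMarkovKernel κ]

/-- The law on the trajectory space `ℕ → E` of the Markov chain with transition kernel `κ` started
from `y`; `walkMeasure hG` is the case `κ = stepKernel hG`. -/
noncomputable def chainMeasure (κ : Kernel E E) [IsMarkovKernel κ] (y : E) : Measure (ℕ → E) :=
  Kernel.trajMeasure (X := fun _ => E) (Measure.dirac y) fun n =>
    κ.comap (fun h : Iic n → E => h ⟨n, Finset.mem_Iic.2 le_rfl⟩) (measurable_pi_apply _)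

theorem lintegral_chainMeasure_zero (y : E) {f : E → ℝ≥0∞} (hf : Measurable f) :
    ∫⁻ ω, f (ω 0) ∂chainMeasure κ y = f y := by
  have hmap : (chainMeasure κ y).map (Preorder.frestrictLe 0) =
      (Measure.dirac y).map (MeasurableEquiv.piUnique fun _ : Iic 0 => E).symm := by
    rw [chainMeasure, Kernel.trajMeasure, Measure.map_comp _ _ (by fun_prop),
      Kernel.traj_map_frestrictLe, Kernel.partialTraj_self, Measure.id_comp]
  have h := lintegral_map (μ := chainMeasure κ y)
    (f := fun h : Iic 0 → E => f (h ⟨0, Finset.mem_Iic.2 le_rfl⟩))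
    (g := Preorder.frestrictLe (π := fun _ => E) 0) (by fun_prop) (by fun_prop)
  rw [hmap, lintegral_map (by fun_prop) (by fun_prop), lintegral_dirac' _ (by fun_prop)] at h
  exact h.symm

theorem setLIntegral_chainMeasure_succ (y : E) (t : ℕ) {A : Set (Iic t → E)}
    (hA : MeasurableSet A) {f : E → ℝ≥0∞} (hf : Measurable f) :
    ∫⁻ ω in Preorder.frestrictLe t ⁻¹' A, f (ω (t + 1)) ∂chainMeasure κ y =
      ∫⁻ ω in Preorder.frestrictLe t ⁻¹' A, ∫⁻ z, f z ∂κ (ω t) ∂chainMeasure κ y := by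
  have h := Kernel.map_frestrictLe_trajMeasure_compProd_eq_map_trajMeasure
    (X := fun _ => E) (μ₀ := Measure.dirac y) (κ := fun n =>
      κ.comap (fun h : Iic n → E => h ⟨n, Finset.mem_Iic.2 le_rfl⟩) (measurable_pi_apply _))
    (a := t)
  have h' := congrArg (fun μ => ∫⁻ p in A ×ˢ Set.univ, f p.2 ∂μ) h
  beta_reduce at h'
  rw [Measure.setLIntegral_compProd (by fun_prop) hA .univ,
    setLIntegral_map (hA.prod .univ) (by fun_prop) (by fun_prop),
    setLIntegral_map hA ?_ (by fun_prop)] at h'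
  · simpa [Set.mk_preimage_prod, chainMeasure] using h'.symm
  · simp only [Measure.restrict_univ, Kernel.comap_apply]
    exact hf.lintegral_kernel.comp (measurable_pi_apply _)

theorem lintegral_hittingTimeOfSet_le {S : Set E} (hS : MeasurableSet S) {f : E → ℝ≥0∞}
    (hf : Measurable f) (hstep : ∀ v ∉ S, 1 + ∫⁻ z, f z ∂κ v ≤ f v) (y : E) :
    ∫⁻ ω, hittingTimeOfSet S ω ∂chainMeasure κ y ≤ f y := by
  let past (t : ℕ) : Set (Iic t → E) := Set.univ.pi fun _ => Sᶜ
  have hpast (t : ℕ) : MeasurableSet (past t) := .univ_pi fun _ => hS.compl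
  let B (t : ℕ) : Set (ℕ → E) := {ω | t < hittingTimeOfSet S ω}
  have hB_eq (t : ℕ) : B t = Preorder.frestrictLe t ⁻¹' past t :=
    setOf_lt_hittingTimeOfSet_eq_preimage S t
  have hB (t : ℕ) : MeasurableSet (B t) := by
    rw [hB_eq]
    exact (Preorder.measurable_frestrictLe t) (hpast t)
  have hdecrease (t : ℕ) : chainMeasure κ y (B t) +
      ∫⁻ ω in B (t + 1), f (ω (t + 1)) ∂chainMeasure κ y ≤
        ∫⁻ ω in B t, f (ω t) ∂chainMeasure κ y := by
    calc _ ≤ chainMeasure κ y (B t) + ∫⁻ ω in B t, f (ω (t + 1)) ∂chainMeasure κ y := by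
          gcongr
          exact fun ω => (Nat.cast_lt.2 t.lt_succ_self).trans (b := ((t + 1 : ℕ) : ℕ∞))
      _ = ∫⁻ ω in B t, (1 + ∫⁻ z, f z ∂κ (ω t)) ∂chainMeasure κ y := by
          rw [lintegral_add_left measurable_const, setLIntegral_one, hB_eq,
            setLIntegral_chainMeasure_succ y t (hpast t) hf]
      _ ≤ _ := setLIntegral_mono (by fun_prop) fun ω hω =>
          hstep _ (notMem_of_lt_hittingAfter hω t.zero_le)
  rw [lintegral_toENNReal_eq_tsum_measure_lt _ hB]
  calc _ ≤ ∫⁻ ω in B 0, f (ω 0) ∂chainMeasure κ y := tsum_le_of_add_succ_le hdecrease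
    _ ≤ ∫⁻ ω, f (ω 0) ∂chainMeasure κ y := setLIntegral_le_lintegral _ _
    _ = f y := lintegral_chainMeasure_zero y hf

variable {V : Type*} [Fintype V] [DecidableEq V] {G : SimpleGraph V} [DecidableRel G.Adj]
  [MeasurableSpace V] [DiscreteMeasurableSpace V] [Nontrivial V]

theorem lintegral_ofReal_stepKernel (hG : G.Connected) {f : V → ℝ} (hf : ∀ v, 0 ≤ f v) (x : V) :
    ∫⁻ z, ENNReal.ofReal (f z) ∂stepKernel hG x = ENNReal.ofReal ((transition G *ᵥ f) x) := by
  change ∫⁻ z, ENNReal.ofReal (f z) ∂(stepPMF hG x).toMeasure = _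
  rw [lintegral_fintype, mulVec, dotProduct,
    ENNReal.ofReal_sum_of_nonneg fun z _ => mul_nonneg (transition_nonneg G x z) (hf z)]
  refine sum_congr rfl fun z _ => ?_
  rw [PMF.toMeasure_apply_singleton _ _ (measurableSet_singleton z),
    ENNReal.ofReal_mul (transition_nonneg G x z), mul_comm]
  rfl

theorem expectedHittingTime_le (hG : G.Connected) {x : V} {f : V → ℝ} (hf : ∀ v, 0 ≤ f v)
    (hstep : ∀ v ≠ x, (transition G *ᵥ f) v + 1 ≤ f v) (y : V) :
    expectedHittingTime hG y x ≤ ENNReal.ofReal (f y) := by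
  refine lintegral_hittingTimeOfSet_le (κ := stepKernel hG) (f := fun v => ENNReal.ofReal (f v))
    (measurableSet_singleton x) .of_discrete (fun v hv => ?_) y
  have hPf : 0 ≤ (transition G *ᵥ f) v :=
    sum_nonneg fun z _ => mul_nonneg (transition_nonneg G v z) (hf z)
  rw [lintegral_ofReal_stepKernel hG hf, ← ENNReal.ofReal_one, ← ENNReal.ofReal_add one_pos.le hPf,
    add_comm]
  exact ENNReal.ofReal_le_ofReal (hstep v hv)

end HittingTime

end LazyWalk

theorem mainTheorem3 {V : Type*} [Fintype V] [DecidableEq V] [Nontrivial V]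
    [MeasurableSpace V] [DiscreteMeasurableSpace V]
    (G : SimpleGraph V) [DecidableRel G.Adj] (hG : G.Connected) :
    LazyWalk.maxHittingTime hG ≤
      ENNReal.ofReal (20 * LazyWalk.avgDegree G / (G.minDegree : ℝ) * (Fintype.card V : ℝ) *
        Real.sqrt (LazyWalk.relaxationTime G + 1)) := by
  refine iSup_le fun y => iSup_le fun x => ?_
  obtain ⟨f, hf0, hstep, hbound⟩ := LazyWalk.exists_transition_mulVec_add_one_eq_and_le hG x
  have hbound' : f y ≤ 20 * LazyWalk.avgDegree G / G.minDegree * Fintype.card V *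
      √(LazyWalk.relaxationTime G + 1) := by
    refine (hbound y).trans ?_
    have havg := LazyWalk.avgDegree_nonneg G
    gcongr
    linarith
  exact (LazyWalk.expectedHittingTime_le hG hf0 (fun v hv => (hstep v hv).le) y).trans
    (ENNReal.ofReal_le_ofReal hbound')
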